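/- \textbf{Setting.} There are $N\ge 1$ arms; pulling arm $i$ gives a reward in $\{0,1\}$, independent of the past given the arm, that is Bernoulli with unknown mean $\mu_i\in[0,1]$. The state of arm $i$ is the pair $s^i=(\alpha_i,\beta_i)$ of parameters of its Beta posterior, initially $(1,1)$; a success adds one to $\alpha_i$, a failure adds one to $\beta_i$. Write $r(s^i)=\frac{\alpha_i}{\alpha_i+\beta_i}$ and $T_i(s^i)=\alpha_i+\beta_i-2$ (the number of pulls of arm $i$). Let $S_t$ be the state of all arms before the pull of step $t$. For a policy $\pi=(\pi_t)_{t=1}^T$ that maps states to arms, the regret is \[ \mathrm{Regret}(\pi,T,\mu)=\sum_{t=1}^T\Bigl(\max_i\mu_i-\mathbb E\bigl[R_{\pi_t(S_t)}\mid\mu\bigr]\Bigr). \] Let $z_t(s^i)$ be the UCB index with parameter $2$, \[ z_t(s^i)=r(s^i)+\sqrt{\frac{2\log t}{T_i(s^i)}}\quad\text{if }T_i(s^i)\ge 1; \] for an arm that has not been pulled yet, where the formula divides by zero, $z_t(s^i)$ may be any real number (possibly depending on the arm, and in particular arbitrarily large) with $z_t(s^i)\ge r(s^i)+\sqrt{2\log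 t}$. Let $v_t(s)=\sum_{i=1}^N\upsilon_t^i(s^i)$ be a linearly separable value function whose components satisfy, for all arms $i$, all $1\le t\le T$ and all states $s^i$ of arm $i$ with at most $t-1$ pulls, \[ \upsilon_{t+1}^i(s^i)=\mathbb E\bigl[\upsilon_{t+1}^i(S'^i)\bigr]+r(s^i)-z_t(s^i), \] where $S'^i$ is $(\alpha_i+1,\beta_i)$ with probability $\frac{\alpha_i}{\alpha_i+\beta_i}$ and $(\alpha_i,\beta_i+1)$ with probability $\frac{\beta_i}{\alpha_i+\beta_i}$. Let $\pi_U$ be a one-step lookahead policy for $v$: at each step $t\le T$, in each state $s$ with $t-1$ pulls in total, it pulls an arm $a$ that maximizes (ties broken arbitrarily) \[ q_t(s,a)=\mathbb E\bigl[r(s,a,S')+v_{t+1}(S')\bigr], \] where $S'$ is the state after a pull of $a$ in $s$, distributed as above in the component of $a$ and unchanged in all others, and $r(s,a,S')\in\{0,1\}$ is the reward of that transition. \textbf{Theorem.} $\mathrm{Regret}(\pi_U,T,\mu)=O(\sqrt{T\log T})$. Precisely: for every $N\ge1$ there is a constant $C$ that depends only on $N$ such that, for all $T\ge 2$, all $\mu\in[0,1]^N$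 and all $z$, $\upsilon$ and $\pi_U$ as above, \[ \mathrm{Regret}(\pi_U,T,\mu)\le C\sqrt{T\log T}. \] -/

import Mathlib

open MeasureTheory ProbabilityTheory
open scoped unitInterval

noncomputable section

namespace ELSV

/-- State of one arm: the parameters `(α, β)` of its Beta posterior.
The uniform prior is `(1, 1)`; a success increases `α`, a failure increases `β`. -/
abbrev ArmState : Type := ℕ × ℕ

/-- State of the bandit with `N` arms. -/
abbrev State (N : ℕ) : Type := Fin N → ArmState

/-- State of an arm after observing one more reward (`true` is reward 1, `false` is reward 0). -/
def ArmState.next (s : ArmState) (r : Bool) : ArmState :=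
  if r then (s.1 + 1, s.2) else (s.1, s.2 + 1)

/-- State of the bandit after pulling arm `i` and observing the reward `r`. -/
def State.next {N : ℕ} (s : State N) (i : Fin N) (r : Bool) : State N :=
  Function.update s i ((s i).next r)

/-- The numerical value of a reward. -/
def rewardValue (r : Bool) : ℝ := if r then 1 else 0

/-- Number of pulls recorded in the state of an arm. -/
def pulls (s : ArmState) : ℕ := s.1 + s.2 - 2

/-- The states of a single arm that are possible before the pull of step `t`:
`α, β ≥ 1` and at most `t - 1` pulls. -/
def armStates (t : ℕ) : Set ArmState :=
  {s | 1 ≤ s.1 ∧ 1 ≤ s.2 ∧ pulls s + 1 ≤ t}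

/-- The states of the bandit before the pull of step `t`:
all `α, β ≥ 1`, and exactly `t - 1` pulls in total. -/
def states (N t : ℕ) : Set (State N) :=
  {s | (∀ i, 1 ≤ (s i).1 ∧ 1 ≤ (s i).2) ∧ (∑ i, pulls (s i)) + 1 = t}

/-- Posterior probability `α / (α + β)` of a success; also the expected immediate reward. -/
def meanReward (s : ArmState) : ℝ := (s.1 : ℝ) / ((s.1 : ℝ) + (s.2 : ℝ))

/-- Posterior predictive expectation of `f` (a function of the next reward) for an arm in
state `s`: success has probability `α / (α + β)`, failure has probability `β / (α + β)`. -/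
def predictive (s : ArmState) (f : Bool → ℝ) : ℝ :=
  (s.1 : ℝ) / ((s.1 : ℝ) + (s.2 : ℝ)) * f true + (s.2 : ℝ) / ((s.1 : ℝ) + (s.2 : ℝ)) * f false

/-- `z t i s` (`1 ≤ t ≤ T`) is the index of the `c`-UCB algorithm,
`r(s) + √(c log t / T_i(s))` with `r(s)` the posterior mean and `T_i(s)` the number of pulls.
For an arm that has not been pulled the formula divides by zero (it means `+∞`: such an arm
has priority). There the index may be any real number, in particular any arbitrarily large one,
that is at least the value of the expression with `T_i(s)` replaced by `1`. -/
def IsUCBIndex {N : ℕ} (c : ℝ) (T : ℕ) (z : ℕ → Fin N → ArmState → ℝ) : Prop :=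
  ∀ t, 1 ≤ t → t ≤ T → ∀ i, ∀ s ∈ armStates t,
    (pulls s ≠ 0 → z t i s = meanReward s + √(c * Real.log t / (pulls s : ℝ))) ∧
    (pulls s = 0 → meanReward s + √(c * Real.log t) ≤ z t i s)

/-- The components `u t i` of a linearly separable value function are ELSV components for the
index `z` and the horizon `T`: for every arm `i`, step `t` and arm state `s` at a time `τ ≤ t`,
`u_{t+1}(s) = E[u_{t+1}(S')] + r(s) - z_t(s)`, with `S'` the state after a pull of the arm. -/
def IsELSV {N : ℕ} (T : ℕ) (z u : ℕ → Fin N → ArmState → ℝ) : Prop :=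
  ∀ t, 1 ≤ t → t ≤ T → ∀ i, ∀ s ∈ armStates t,
    u (t + 1) i s =
      predictive s (fun r => u (t + 1) i (s.next r)) + meanReward s - z t i s

/-- The linearly separable value function with components `u`. -/
def separable {N : ℕ} (u : ℕ → Fin N → ArmState → ℝ) (t : ℕ) (s : State N) : ℝ :=
  ∑ i, u t i (s i)

/-- `q_t(s, a) = E[r(s, a, S') + v_{t+1}(S')]`, with `S'` the state after pulling arm `a`. -/
def qValue {N : ℕ} (v : ℕ → State N → ℝ) (t : ℕ) (s : State N) (a : Fin N) : ℝ :=
  predictive (s a) (fun r => rewardValue r + v (t + 1) (s.next a r))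

/-- `π` is a one-step lookahead policy for `v` up to the horizon `T`: at each step it pulls an
arm that maximizes `q_t(s, ·)`; ties are broken arbitrarily. -/
def IsLookahead {N : ℕ} (T : ℕ) (v : ℕ → State N → ℝ) (π : ℕ → State N → Fin N) : Prop :=
  ∀ t, 1 ≤ t → t ≤ T → ∀ s ∈ states N t, ∀ a, qValue v t s a ≤ qValue v t s (π t s)

/-- The Bernoulli law of the reward of an arm with mean `p`. -/
def rewardLaw (p : I) : PMF Bool := (bernoulliMeasure true false p).toPMF

/-- Joint law of the state before a pull and of the reward of that pull, when the state has
law `L`, the decision rule is `d`, and the true means of the arms are `μ`. -/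
def stepLaw {N : ℕ} (μ : Fin N → I) (d : State N → Fin N) (L : PMF (State N)) :
    PMF (State N × Bool) :=
  L.bind fun s => (rewardLaw (μ (d s))).map fun r => (s, r)

/-- Law of the state after `k` pulls under the policy `π`, when the true means of the arms are
`μ`. The bandit starts in the state in which all arms have the parameters `(1, 1)`, and pull
number `k + 1` is made at the step `t = k + 1`. -/
def stateLaw {N : ℕ} (μ : Fin N → I) (π : ℕ → State N → Fin N) : ℕ → PMF (State N)
  | 0 => PMF.pure fun _ => (1, 1)
  | k + 1 => (stepLaw μ (π (k + 1)) (stateLaw μ π k)).map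
      fun x => x.1.next (π (k + 1) x.1) x.2

/-- `E[R_{π(S_t)} | μ]`: expected reward at step `t ≥ 1`. -/
def expectedReward {N : ℕ} (μ : Fin N → I) (π : ℕ → State N → Fin N) (t : ℕ) : ℝ :=
  ∫ x, rewardValue x.2 ∂(stepLaw μ (π t) (stateLaw μ π (t - 1))).toMeasure

/-- The regret of the policy `π` over `T` steps when the true means of the arms are `μ`. -/
def regret {N : ℕ} (π : ℕ → State N → Fin N) (T : ℕ) (μ : Fin N → I) : ℝ :=
  ∑ t ∈ Finset.Icc 1 T, ((⨆ i, (μ i : ℝ)) - expectedReward μ π t)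

end ELSV

end

/-!
By the recursion of the components, `q_t(s, a) = v_{t+1}(s) + z_t(s^a)`, so a one-step lookahead
policy pulls an arm of maximal index (`index_le_of_isLookahead`), and the claim is a worst-case
regret bound for UCB.

*Concentration.* For an arm with `S` successes in `n` pulls and true mean `p`, Hoeffding's lemma
makes `exp (l (S - n p) - l² n / 8)` a supermartingale of expectation at most one, under any policy.
If the posterior mean `(1 + S) / (2 + n)` misses `p` by at least `w = √(2 log t / n)`, then the
supermartingale with `l = 4 w` or `l = -4 w` is at least `t ^ 4 / 2`; the bias of the posterior mean
costs only the factor `1 / 2`. Summing over the possible values of `n`, which determine `l`, replaces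
the union bound over rewards, so the rewards need not be realized as independent sequences. The
expected contribution of all failures at step `t` is thus at most `4 N / t ^ 2`.

*Regret of one step.* If no confidence bound fails, pulling an arm `a` with `n ≥ 1` pulls costs at
most `2 √(2 log t / n) ≤ 8 √(log T) (√(n + 1) - √n)`; for `n = 0` the last expression is at least
one, the largest possible cost (`gap_le`). The bound is an increment of the potential `∑ i, √(nᵢ)`,
which is at most `N √T` after `T` pulls, and the sum telescopes.
-/

namespace ELSV

/-! ### The expectation functional -/

/-- The Markov operator of one pull under the decision rule `d`: the expected value of `f` at the
next state, as a function of the current one. -/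
noncomputable def transition {N : ℕ} (μ : Fin N → I) (d : State N → Fin N) :
    (State N → ℝ) →ₗ[ℝ] (State N → ℝ) where
  toFun f s := (μ (d s) : ℝ) * f (s.next (d s) true) + (1 - (μ (d s) : ℝ)) * f (s.next (d s) false)
  map_add' f g := by ext s; simp only [Pi.add_apply]; ring
  map_smul' c f := by ext s; simp only [Pi.smul_apply, smul_eq_mul, RingHom.id_apply]; ring

/-- The expectation of a function of the state after `k` pulls. It is a finite sum, so that it is
linear and monotone without any integrability condition. -/
noncomputable def expectation {N : ℕ} (μ : Fin N → I) (π : ℕ → State N → Fin N) :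
    ℕ → (State N → ℝ) →ₗ[ℝ] ℝ
  | 0 => LinearMap.proj fun _ => (1, 1)
  | k + 1 => (expectation μ π k).comp (transition μ (π (k + 1)))

variable {N : ℕ} {μ : Fin N → I} {π : ℕ → State N → Fin N}

lemma transition_apply (d : State N → Fin N) (f : State N → ℝ) (s : State N) :
    transition μ d f s =
      (μ (d s) : ℝ) * f (s.next (d s) true) + (1 - (μ (d s) : ℝ)) * f (s.next (d s) false) := rfl

lemma pulls_next {s : ArmState} (h₁ : 1 ≤ s.1) (h₂ : 1 ≤ s.2) (r : Bool) :
    pulls (s.next r) = pulls s + 1 := by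
  cases r <;> simp [ArmState.next, pulls] <;> omega

lemma State.next_self (s : State N) (i : Fin N) (r : Bool) : s.next i r i = (s i).next r := by
  simp [State.next]

lemma State.next_of_ne (s : State N) {i j : Fin N} (h : j ≠ i) (r : Bool) :
    s.next i r j = s j := by
  simp [State.next, h]

lemma sum_next {M : Type*} [AddCommMonoid M] (g : Fin N → ArmState → M) (s : State N) (i : Fin N)
    (r : Bool) :
    ∑ j, g j (s.next i r j) = g i ((s i).next r) + ∑ j ∈ Finset.univ.erase i, g j (s j) := by
  rw [← Finset.add_sum_erase _ _ (Finset.mem_univ i), State.next_self]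
  congr 1
  refine Finset.sum_congr rfl fun j hj => ?_
  rw [State.next_of_ne _ (Finset.ne_of_mem_erase hj)]

lemma next_mem_states {t : ℕ} {s : State N} (hs : s ∈ states N t) (i : Fin N) (r : Bool) :
    s.next i r ∈ states N (t + 1) := by
  obtain ⟨h, rfl⟩ := hs
  refine ⟨fun j => ?_, ?_⟩
  · by_cases hj : j = i
    · subst hj
      have := h j
      rw [State.next_self]
      cases r <;> simp [ArmState.next] <;> omega
    · rw [State.next_of_ne _ hj]
      exact h j
  · rw [sum_next fun _ => pulls, pulls_next (h i).1 (h i).2,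
      ← Finset.add_sum_erase _ _ (Finset.mem_univ i)]
    ring

lemma mem_armStates_of_mem_states {t : ℕ} {s : State N} (hs : s ∈ states N t) (i : Fin N) :
    s i ∈ armStates t := by
  obtain ⟨h, rfl⟩ := hs
  refine ⟨(h i).1, (h i).2, ?_⟩
  have := Finset.single_le_sum (f := fun j => pulls (s j)) (fun j _ => Nat.zero_le _)
    (Finset.mem_univ i)
  simpa using this

/-- It suffices to compare the functions on the states that can occur after `k` pulls. -/
lemma expectation_mono (k : ℕ) {f g : State N → ℝ} (h : ∀ s ∈ states N (k + 1), f s ≤ g s) :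
    expectation μ π k f ≤ expectation μ π k g := by
  induction k generalizing f g with
  | zero => exact h _ ⟨by simp, by simp [pulls]⟩
  | succ k ih =>
    refine ih fun s hs => ?_
    simp only [transition_apply]
    have h1 := h _ (next_mem_states hs (π (k + 1) s) true)
    have h2 := h _ (next_mem_states hs (π (k + 1) s) false)
    have h3 := (μ (π (k + 1) s)).2.1
    have h4 := (μ (π (k + 1) s)).2.2
    exact add_le_add (mul_le_mul_of_nonneg_left h1 h3)
      (mul_le_mul_of_nonneg_left h2 (by linarith))

lemma expectation_const (k : ℕ) (c : ℝ) : expectation μ π k (fun _ => c) = c := by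
  induction k with
  | zero => rfl
  | succ k ih =>
    have : transition μ (π (k + 1)) (fun _ => c) = fun _ => c := by
      ext s; rw [transition_apply]; ring
    simp only [expectation, LinearMap.comp_apply, this, ih]

/-! ### The expectation functional computes integrals -/

lemma integral_bind_of_bounded {α β : Type*} [MeasurableSpace α] [DiscreteMeasurableSpace α]
    [MeasurableSpace β] [DiscreteMeasurableSpace β] [Countable α] [Countable β]
    (p : PMF α) (q : α → PMF β) {f : β → ℝ} {C : ℝ} (hf : ∀ b, |f b| ≤ C) :
    ∫ b, f b ∂(p.bind q).toMeasure = ∫ a, ∫ b, f b ∂(q a).toMeasure ∂p.toMeasure := by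
  have hint : ∀ r : PMF β, Integrable f r.toMeasure := fun r =>
    Integrable.of_bound (Measurable.of_discrete.aestronglyMeasurable) C (.of_forall hf)
  have hsum : (p.bind q).toMeasure = Measure.sum fun a => p a • (q a).toMeasure := by
    ext s hs
    rw [PMF.toMeasure_bind_apply _ _ _ hs, Measure.sum_apply _ hs]
    simp
  rw [PMF.integral_eq_tsum p]
  · have h := hint (p.bind q)
    rw [hsum] at h ⊢
    rw [integral_sum_measure h]
    simp only [integral_smul_measure]
  · refine Integrable.of_bound (Measurable.of_discrete.aestronglyMeasurable) C
      (.of_forall fun a => ?_)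
    have := norm_integral_le_of_norm_le_const (μ := (q a).toMeasure) (f := f) (C := C)
      (.of_forall hf)
    simpa using this

lemma integral_map_pmf {α β : Type*} [MeasurableSpace α] [DiscreteMeasurableSpace α]
    [MeasurableSpace β] [DiscreteMeasurableSpace β] [Countable β]
    (p : PMF α) (g : α → β) (f : β → ℝ) :
    ∫ b, f b ∂(p.map g).toMeasure = ∫ a, f (g a) ∂p.toMeasure := by
  have h : p.toMeasure.map g = (p.map g).toMeasure := PMF.toMeasure_map g p .of_discrete
  rw [← h, integral_map Measurable.of_discrete.aemeasurable Measurable.of_discrete.aestronglyMeasurable]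

lemma integral_stepLaw (d : State N → Fin N) (L : PMF (State N)) {f : State N × Bool → ℝ} {C : ℝ}
    (hf : ∀ x, |f x| ≤ C) :
    ∫ x, f x ∂(stepLaw μ d L).toMeasure =
      ∫ s, ((μ (d s) : ℝ) * f (s, true) + (1 - (μ (d s) : ℝ)) * f (s, false)) ∂L.toMeasure := by
  rw [stepLaw, integral_bind_of_bounded _ _ hf]
  congr with s
  rw [integral_map_pmf, rewardLaw, Measure.toPMF_toMeasure, integral_bernoulliMeasure]
  simp

lemma integral_stateLaw (k : ℕ) {f : State N → ℝ} {C : ℝ} (hf : ∀ s, |f s| ≤ C) :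
    ∫ s, f s ∂(stateLaw μ π k).toMeasure = expectation μ π k f := by
  induction k generalizing f with
  | zero =>
    rw [stateLaw, PMF.toMeasure_pure, integral_dirac]
    rfl
  | succ k ih =>
    rw [stateLaw, integral_map_pmf, integral_stepLaw _ _ (fun x => hf _)]
    refine ih fun s => ?_
    have h3 := (μ (π (k + 1) s)).2.1
    have h4 := (μ (π (k + 1) s)).2.2
    have h1 := abs_le.1 (hf (s.next (π (k + 1) s) true))
    have h2 := abs_le.1 (hf (s.next (π (k + 1) s) false))
    rw [abs_le]
    constructor <;> nlinarith

lemma expectedReward_eq (t : ℕ) :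
    expectedReward μ π t = expectation μ π (t - 1) fun s => (μ (π t s) : ℝ) := by
  rw [expectedReward, integral_stepLaw (f := fun x => rewardValue x.2) (C := 1)]
  · simp only [rewardValue, if_true, Bool.false_eq_true, if_false, mul_one, mul_zero, add_zero]
    refine integral_stateLaw (C := 1) _ fun s => ?_
    rw [abs_of_nonneg (μ _).2.1]
    exact (μ _).2.2
  · rintro ⟨s, r⟩
    cases r <;> simp [rewardValue]

/-! ### One-step lookahead maximizes the index -/

lemma qValue_separable {T t : ℕ} {z u : ℕ → Fin N → ArmState → ℝ} (hu : IsELSV T z u)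
    (h1 : 1 ≤ t) (hT : t ≤ T) {s : State N} (hs : s ∈ states N t) (a : Fin N) :
    qValue (separable u) t s a = separable u (t + 1) s + z t a (s a) := by
  have h := hu t h1 hT a (s a) (mem_armStates_of_mem_states hs a)
  have hpos : (0 : ℝ) < (s a).1 + (s a).2 := by
    have := (hs.1 a).1
    positivity
  simp only [qValue, separable, sum_next (u (t + 1)), predictive]
  rw [← Finset.add_sum_erase _ (fun i => u (t + 1) i (s i)) (Finset.mem_univ a), h]
  simp only [predictive, meanReward, rewardValue]
  field_simp
  simp
  ring

lemma index_le_of_isLookahead {T t : ℕ} {z u : ℕ → Fin N → ArmState → ℝ} (hu : IsELSV T z u)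
    (hπ : IsLookahead T (separable u) π) (h1 : 1 ≤ t) (hT : t ≤ T) {s : State N}
    (hs : s ∈ states N t) (a : Fin N) : z t a (s a) ≤ z t (π t s) (s (π t s)) := by
  have h := hπ t h1 hT s hs a
  rw [qValue_separable hu h1 hT hs, qValue_separable hu h1 hT hs] at h
  linarith

/-! ### The exponential supermartingale of an arm -/

/-- Observed minus expected successes `S - n p` of an arm with true mean `p`, where
`S = α - 1` and `n = α + β - 2`. -/
noncomputable def deviation (p : ℝ) (s : ArmState) : ℝ :=
  ((s.1 : ℝ) - 1) * (1 - p) - ((s.2 : ℝ) - 1) * p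

/-- The exponential supermartingale `exp (l (S - n p) - l² n / 8)` of Hoeffding. -/
noncomputable def expSupermartingale (p l : ℝ) (s : ArmState) : ℝ :=
  Real.exp (l * deviation p s - l ^ 2 / 8 * pulls s)

lemma bernoulli_mgf_le (p : I) (l : ℝ) :
    (p : ℝ) * Real.exp (l * (1 - p)) + (1 - (p : ℝ)) * Real.exp (-(l * p)) ≤
      Real.exp (l ^ 2 / 8) := by
  have h := (hasSubgaussianMGF_of_mem_Icc (μ := bernoulliMeasure true false p) (X := rewardValue)
    (a := 0) (b := 1) Measurable.of_discrete.aemeasurable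
    (.of_forall fun r => by cases r <;> simp [rewardValue])).mgf_le l
  simp only [mgf, integral_bernoulliMeasure, rewardValue] at h
  simp at h
  convert h using 2
  ring

lemma expSupermartingale_step_le (p : I) (l : ℝ) {s : ArmState} (h₁ : 1 ≤ s.1) (h₂ : 1 ≤ s.2) :
    (p : ℝ) * expSupermartingale p l (s.next true) +
      (1 - (p : ℝ)) * expSupermartingale p l (s.next false) ≤ expSupermartingale p l s := by
  have ht : expSupermartingale p l (s.next true) =
      expSupermartingale p l s * Real.exp (-(l ^ 2 / 8)) * Real.exp (l * (1 - p)) := by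
    rw [expSupermartingale, expSupermartingale, pulls_next h₁ h₂, ← Real.exp_add, ← Real.exp_add]
    simp [deviation, ArmState.next]
    ring
  have hf : expSupermartingale p l (s.next false) =
      expSupermartingale p l s * Real.exp (-(l ^ 2 / 8)) * Real.exp (-(l * p)) := by
    rw [expSupermartingale, expSupermartingale, pulls_next h₁ h₂, ← Real.exp_add, ← Real.exp_add]
    simp [deviation, ArmState.next]
    ring
  calc _ = expSupermartingale p l s * Real.exp (-(l ^ 2 / 8)) *
        ((p : ℝ) * Real.exp (l * (1 - p)) + (1 - (p : ℝ)) * Real.exp (-(l * p))) := by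
          rw [ht, hf]; ring
    _ ≤ expSupermartingale p l s * Real.exp (-(l ^ 2 / 8)) * Real.exp (l ^ 2 / 8) :=
          mul_le_mul_of_nonneg_left (bernoulli_mgf_le p l)
            (mul_nonneg (Real.exp_pos _).le (Real.exp_pos _).le)
    _ = expSupermartingale p l s := by
          rw [mul_assoc, ← Real.exp_add]; simp

lemma expectation_expSupermartingale_le (i : Fin N) (l : ℝ) (k : ℕ) :
    expectation μ π k (fun s => expSupermartingale (μ i) l (s i)) ≤ 1 := by
  induction k with
  | zero => simp [expectation, expSupermartingale, deviation, pulls]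
  | succ k ih =>
    refine (expectation_mono k fun s hs => ?_).trans ih
    rw [transition_apply]
    by_cases h : i = π (k + 1) s
    · subst h
      simp only [State.next_self]
      exact expSupermartingale_step_le _ _ (hs.1 _).1 (hs.1 _).2
    · simp only [State.next_of_ne _ h]
      linarith

/-! ### Confidence bounds -/

/-- The confidence radius `√(2 log t / n)` after `n` pulls. -/
noncomputable def radius (t n : ℕ) : ℝ := √(2 * Real.log t / (n : ℝ))

lemma radius_nonneg (t n : ℕ) : 0 ≤ radius t n := Real.sqrt_nonneg _

lemma radius_sq_mul (t : ℕ) {n : ℕ} (hn : n ≠ 0) :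
    radius t n ^ 2 * n = 2 * Real.log t := by
  have : 0 ≤ Real.log t := Real.log_natCast_nonneg t
  rw [radius, Real.sq_sqrt (by positivity)]
  field_simp

lemma cast_pulls {s : ArmState} (h₁ : 1 ≤ s.1) (h₂ : 1 ≤ s.2) :
    (pulls s : ℝ) = s.1 + s.2 - 2 := by
  rw [pulls, Nat.cast_sub (by omega)]
  push_cast
  ring

lemma one_le_mul_exp {t : ℕ} (ht : 1 ≤ t) {x : ℝ} (hx : 4 * Real.log t - 1 / 2 ≤ x) :
    1 ≤ 2 / (t : ℝ) ^ 4 * Real.exp x := by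
  have htpos : (0 : ℝ) < t := by positivity
  have h4 : Real.exp (4 * Real.log t) = (t : ℝ) ^ 4 := by
    rw [mul_comm, Real.exp_mul, Real.exp_log htpos]
    norm_cast
  have h1 : (1 : ℝ) / 2 ≤ Real.exp (-(1 / 2)) := by
    have := Real.add_one_le_exp (-(1 / 2 : ℝ))
    linarith
  have h2 : (t : ℝ) ^ 4 * (1 / 2) ≤ Real.exp x := by
    rw [← h4]
    refine (mul_le_mul_of_nonneg_left h1 (Real.exp_pos _).le).trans ?_
    rw [← Real.exp_add]
    exact Real.exp_le_exp.2 (by linarith)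
  rw [div_mul_eq_mul_div, le_div_iff₀ (by positivity)]
  linarith

/-- If the posterior mean is too large by the confidence radius `w`, the supermartingale with
parameter `4 w` is at least `t ^ 4 / 2`. -/
lemma one_le_of_add_radius_le_meanReward {t : ℕ} (ht : 1 ≤ t) (p : I) {s : ArmState} (h₁ : 1 ≤ s.1)
    (h₂ : 1 ≤ s.2) (hn : pulls s ≠ 0) (h : p + radius t (pulls s) ≤ meanReward s) :
    1 ≤ 2 / (t : ℝ) ^ 4 * expSupermartingale p (4 * radius t (pulls s)) s := by
  refine one_le_mul_exp ht ?_
  have hw := radius_nonneg t (pulls s)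
  have hsq := radius_sq_mul t hn
  set w := radius t (pulls s)
  -- With `n = α + β - 2` pulls, `h` reads `(n + 2) (p + w) ≤ α`; the choice `l = 4 w` maximizes
  -- `l n w - l² n / 8`, whose maximum `2 n w²` is `4 log t`, and the remaining `8 w² - 4 w` is at
  -- least `-1 / 2`.
  rw [meanReward, le_div_iff₀ (by positivity)] at h
  have hp := p.2.1
  rw [cast_pulls h₁ h₂] at hsq ⊢
  have hdev : w * (s.1 + s.2) - 1 ≤ deviation p s := by
    rw [deviation]; nlinarith
  nlinarith [mul_le_mul_of_nonneg_left hdev hw, sq_nonneg (4 * w - 1)]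

lemma one_le_of_meanReward_add_radius_le {t : ℕ} (ht : 1 ≤ t) (p : I) {s : ArmState} (h₁ : 1 ≤ s.1)
    (h₂ : 1 ≤ s.2) (hn : pulls s ≠ 0) (h : meanReward s + radius t (pulls s) ≤ p) :
    1 ≤ 2 / (t : ℝ) ^ 4 * expSupermartingale p (-(4 * radius t (pulls s))) s := by
  refine one_le_mul_exp ht ?_
  have hw := radius_nonneg t (pulls s)
  have hsq := radius_sq_mul t hn
  set w := radius t (pulls s)
  rw [← le_sub_iff_add_le, meanReward, div_le_iff₀ (by positivity)] at h
  have hp := p.2.2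
  rw [cast_pulls h₁ h₂] at hsq ⊢
  have hdev : w * (s.1 + s.2) - 1 ≤ -deviation p s := by
    rw [deviation]; nlinarith
  nlinarith [mul_le_mul_of_nonneg_left hdev hw, sq_nonneg (4 * w - 1)]

/-- An upper bound for the indicator of the event that, before step `t`, the posterior mean of some
arm misses the true mean by at least the confidence radius. -/
noncomputable def failureBound (μ : Fin N → I) (t : ℕ) (s : State N) : ℝ :=
  ∑ i, ∑ m ∈ Finset.range t,
    (2 / (t : ℝ) ^ 4 * expSupermartingale (μ i) (4 * radius t m) (s i) +
      2 / (t : ℝ) ^ 4 * expSupermartingale (μ i) (-(4 * radius t m)) (s i))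

lemma expSupermartingale_pos (p l : ℝ) (s : ArmState) : 0 < expSupermartingale p l s :=
  Real.exp_pos _

lemma le_failureBound {t : ℕ} {s : State N} (hs : s ∈ states N t) (i : Fin N) :
    2 / (t : ℝ) ^ 4 * expSupermartingale (μ i) (4 * radius t (pulls (s i))) (s i) +
      2 / (t : ℝ) ^ 4 * expSupermartingale (μ i) (-(4 * radius t (pulls (s i)))) (s i) ≤
      failureBound μ t s := by
  have hpos : ∀ (j : Fin N) (m : ℕ),
      0 ≤ 2 / (t : ℝ) ^ 4 * expSupermartingale (μ j) (4 * radius t m) (s j) +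
      2 / (t : ℝ) ^ 4 * expSupermartingale (μ j) (-(4 * radius t m)) (s j) := fun j m => by
    have := expSupermartingale_pos (μ j) (4 * radius t m) (s j)
    have := expSupermartingale_pos (μ j) (-(4 * radius t m)) (s j)
    positivity
  refine le_trans ?_ (Finset.single_le_sum (fun j _ => Finset.sum_nonneg fun m _ => hpos j m)
    (Finset.mem_univ i))
  refine Finset.single_le_sum (f := fun m =>
    2 / (t : ℝ) ^ 4 * expSupermartingale (μ i) (4 * radius t m) (s i) +
      2 / (t : ℝ) ^ 4 * expSupermartingale (μ i) (-(4 * radius t m)) (s i))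
    (fun m _ => hpos i m) (Finset.mem_range.2 ?_)
  exact (mem_armStates_of_mem_states hs i).2.2

lemma failureBound_nonneg (t : ℕ) (s : State N) : 0 ≤ failureBound μ t s := by
  refine Finset.sum_nonneg fun i _ => Finset.sum_nonneg fun m _ => ?_
  have := expSupermartingale_pos (μ i) (4 * radius t m) (s i)
  have := expSupermartingale_pos (μ i) (-(4 * radius t m)) (s i)
  positivity

lemma expectation_failureBound_le {t : ℕ} (ht : 1 ≤ t) (k : ℕ) :
    expectation μ π k (failureBound μ t) ≤ 4 * N * (1 / (t : ℝ) ^ 2) := by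
  have hfun : failureBound μ t = ∑ i, ∑ m ∈ Finset.range t,
      ((2 / (t : ℝ) ^ 4) • (fun s : State N => expSupermartingale (μ i) (4 * radius t m) (s i)) +
      (2 / (t : ℝ) ^ 4) • fun s : State N =>
        expSupermartingale (μ i) (-(4 * radius t m)) (s i)) := by
    ext s
    simp [failureBound, Finset.sum_apply]
  have ht' : (1 : ℝ) ≤ t := by exact_mod_cast ht
  have hc : (0 : ℝ) ≤ 2 / (t : ℝ) ^ 4 := by positivity
  rw [hfun]
  simp only [map_sum, map_add, map_smul, smul_eq_mul]
  calc _ ≤ ∑ i : Fin N, ∑ m ∈ Finset.range t, (2 / (t : ℝ) ^ 4 * 1 + 2 / (t : ℝ) ^ 4 * 1) := by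
        gcongr <;> exact expectation_expSupermartingale_le _ _ _
    _ = 4 * N * (1 / (t : ℝ) ^ 3) := by
        simp
        field_simp
        ring
    _ ≤ 4 * N * (1 / (t : ℝ) ^ 2) := by
        gcongr
        norm_num

/-! ### The regret of one step -/

lemma inv_sqrt_le_sqrt_add_one_sub {n : ℕ} (hn : n ≠ 0) :
    1 / √(n : ℝ) ≤ 2 * √2 * (√((n : ℝ) + 1) - √(n : ℝ)) := by
  have hn1 : (1 : ℝ) ≤ n := by exact_mod_cast Nat.one_le_iff_ne_zero.2 hn
  have hx : 0 < √(n : ℝ) := Real.sqrt_pos.2 (by linarith)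
  have hxs := Real.sq_sqrt (show (0 : ℝ) ≤ n by linarith)
  have hys := Real.sq_sqrt (show (0 : ℝ) ≤ (n : ℝ) + 1 by linarith)
  have h2s := Real.sq_sqrt (show (0 : ℝ) ≤ 2 by norm_num)
  have hy : √((n : ℝ) + 1) ≤ √2 * √(n : ℝ) := by
    rw [← Real.sqrt_mul (by norm_num)]
    exact Real.sqrt_le_sqrt (by linarith)
  have h2 : (1 : ℝ) ≤ √2 := Real.one_le_sqrt.2 (by norm_num)
  have hy0 : 0 < √((n : ℝ) + 1) := Real.sqrt_pos.2 (by linarith)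
  set x := √(n : ℝ)
  set y := √((n : ℝ) + 1)
  have hd : y - x = 1 / (y + x) := by
    field_simp
    linarith
  rw [hd, mul_one_div, div_le_div_iff₀ hx (by positivity)]
  nlinarith

lemma one_le_two_mul_log {t : ℕ} (ht : 2 ≤ t) : 1 ≤ 2 * Real.log t := by
  have h : Real.log 2 ≤ Real.log t := Real.log_le_log (by norm_num) (by exact_mod_cast ht)
  have := Real.log_two_gt_d9
  linarith

lemma gap_le {T t : ℕ} (hT2 : 2 ≤ T) {z : ℕ → Fin N → ArmState → ℝ} (hz : IsUCBIndex 2 T z)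
    (h1 : 1 ≤ t) (hT : t ≤ T) {s : State N} (hs : s ∈ states N t) {a : Fin N}
    (ha : ∀ i, z t i (s i) ≤ z t a (s a)) (j : Fin N) :
    (μ j : ℝ) - μ a ≤
      8 * √(Real.log T) * (√((pulls (s a) : ℝ) + 1) - √(pulls (s a) : ℝ)) + failureBound μ t s := by
  have hj1 := (μ j).2.2
  have ha0 := (μ a).2.1
  have hR := failureBound_nonneg (μ := μ) t s
  have hlogT : 1 / 4 ≤ √(Real.log T) := by
    refine Real.le_sqrt_of_sq_le ?_
    have := one_le_two_mul_log hT2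
    norm_num
    linarith
  by_cases hna : pulls (s a) = 0
  · simp only [hna, CharP.cast_eq_zero, zero_add, Real.sqrt_one, Real.sqrt_zero, sub_zero, mul_one]
    linarith
  -- An arm has been pulled, so `t ≥ 2`.
  have ht2 : 2 ≤ t := by
    have := (mem_armStates_of_mem_states hs a).2.2
    omega
  have hza := (hz t h1 hT a _ (mem_armStates_of_mem_states hs a)).1 hna
  have hinc : 2 * radius t (pulls (s a)) ≤
      8 * √(Real.log T) * (√((pulls (s a) : ℝ) + 1) - √(pulls (s a) : ℝ)) := by
    have hlog : √(Real.log t) ≤ √(Real.log T) :=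
      Real.sqrt_le_sqrt (Real.log_le_log (by positivity) (by exact_mod_cast hT))
    have h2s : √2 * √2 = (2 : ℝ) := Real.mul_self_sqrt (by norm_num)
    have hi := inv_sqrt_le_sqrt_add_one_sub hna
    have hlog0 := Real.log_natCast_nonneg t
    calc 2 * radius t (pulls (s a)) = 2 * √2 * √(Real.log t) * (1 / √(pulls (s a) : ℝ)) := by
          rw [radius, Real.sqrt_div (by positivity), Real.sqrt_mul (by norm_num)]
          ring
      _ ≤ 2 * √2 * √(Real.log T) *
          (2 * √2 * (√((pulls (s a) : ℝ) + 1) - √(pulls (s a) : ℝ))) := by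
          gcongr
      _ = 4 * (√2 * √2) * √(Real.log T) *
          (√((pulls (s a) : ℝ) + 1) - √(pulls (s a) : ℝ)) := by ring
      _ = _ := by rw [h2s]; ring
  have hinc0 : 0 ≤ 8 * √(Real.log T) * (√((pulls (s a) : ℝ) + 1) - √(pulls (s a) : ℝ)) :=
    le_trans (mul_nonneg (by norm_num) (radius_nonneg _ _)) hinc
  rcases le_or_gt (μ j : ℝ) (μ a + 2 * radius t (pulls (s a))) with hgap | hgap
  · linarith
  -- The gap exceeds twice the radius of `a`, so the confidence interval of `a` or `j` fails.
  suffices 1 ≤ failureBound μ t s by linarith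
  rcases le_or_gt ((μ a : ℝ) + radius t (pulls (s a))) (meanReward (s a)) with hup | hup
  · have := one_le_of_add_radius_le_meanReward h1 (μ a) (hs.1 a).1 (hs.1 a).2 hna hup
    have h' := le_failureBound (μ := μ) hs a
    have := expSupermartingale_pos (μ a) (-(4 * radius t (pulls (s a)))) (s a)
    have : 0 ≤ 2 / (t : ℝ) ^ 4 *
      expSupermartingale (μ a) (-(4 * radius t (pulls (s a)))) (s a) := by positivity
    linarith
  have hzj := hz t h1 hT j _ (mem_armStates_of_mem_states hs j)
  have hzlt : z t j (s j) < μ j := by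
    refine (ha j).trans_lt ?_
    rw [hza]
    change meanReward (s a) + radius t (pulls (s a)) < _
    linarith
  by_cases hnj : pulls (s j) = 0
  · -- The index of an arm that has not been pulled is at least `1`.
    have hm : 0 ≤ meanReward (s j) := by rw [meanReward]; positivity
    have := hzj.2 hnj
    have : 1 ≤ √(2 * Real.log t) := Real.one_le_sqrt.2 (one_le_two_mul_log ht2)
    linarith
  · have hlow : meanReward (s j) + radius t (pulls (s j)) ≤ μ j := by
      rw [hzj.1 hnj] at hzlt
      exact hzlt.le
    have := one_le_of_meanReward_add_radius_le h1 (μ j) (hs.1 j).1 (hs.1 j).2 hnj hlow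
    have h' := le_failureBound (μ := μ) hs j
    have := expSupermartingale_pos (μ j) (4 * radius t (pulls (s j))) (s j)
    have : 0 ≤ 2 / (t : ℝ) ^ 4 *
      expSupermartingale (μ j) (4 * radius t (pulls (s j))) (s j) := by positivity
    linarith

/-! ### Summation over the horizon -/

/-- The potential `∑ i, √(nᵢ)`, where `nᵢ` is the number of pulls of arm `i`. -/
noncomputable def sqrtPotential (s : State N) : ℝ := ∑ i, √(pulls (s i) : ℝ)

lemma transition_sqrtPotential (d : State N → Fin N) {t : ℕ} {s : State N} (hs : s ∈ states N t) :
    transition μ d sqrtPotential s =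
      sqrtPotential s + (√((pulls (s (d s)) : ℝ) + 1) - √(pulls (s (d s)) : ℝ)) := by
  have h : ∀ r, sqrtPotential (s.next (d s) r) =
      sqrtPotential s + (√((pulls (s (d s)) : ℝ) + 1) - √(pulls (s (d s)) : ℝ)) := fun r => by
    simp only [sqrtPotential]
    rw [sum_next fun _ x => √(pulls x : ℝ), pulls_next (hs.1 _).1 (hs.1 _).2,
      ← Finset.add_sum_erase _ (fun i => √(pulls (s i) : ℝ)) (Finset.mem_univ (d s))]
    push_cast
    ring
  rw [transition_apply, h, h]
  ring

lemma sub_expectedReward_le {T k : ℕ} (hT2 : 2 ≤ T) {z u : ℕ → Fin N → ArmState → ℝ}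
    (hz : IsUCBIndex 2 T z) (hu : IsELSV T z u) (hπ : IsLookahead T (separable u) π)
    (hT : k + 1 ≤ T) (j : Fin N) :
    (μ j : ℝ) - expectedReward μ π (k + 1) ≤
      8 * √(Real.log T) *
        (expectation μ π (k + 1) sqrtPotential - expectation μ π k sqrtPotential) +
      4 * N * (1 / ((k + 1 : ℕ) : ℝ) ^ 2) := by
  have hmono := expectation_mono (μ := μ) (π := π) k
    (f := (fun _ => (μ j : ℝ)) - fun s => (μ (π (k + 1) s) : ℝ))
    (g := (8 * √(Real.log T)) • (transition μ (π (k + 1)) sqrtPotential - sqrtPotential) +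
      failureBound μ (k + 1)) fun s hs => by
    have := gap_le (μ := μ) hT2 hz (by omega) hT hs
      (index_le_of_isLookahead hu hπ (by omega) hT hs) j
    simpa [transition_sqrtPotential _ hs] using this
  rw [map_sub, map_add, map_smul, map_sub, expectation_const, smul_eq_mul] at hmono
  rw [expectedReward_eq, Nat.add_sub_cancel]
  refine hmono.trans (add_le_add le_rfl (expectation_failureBound_le (by omega) k))

lemma sum_one_div_sq_le (n : ℕ) :
    ∑ k ∈ Finset.range n, 1 / ((k + 1 : ℕ) : ℝ) ^ 2 ≤ 2 - 1 / (n : ℝ) := by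
  induction n with
  | zero =>
    -- Here `1 / n` is `1 / 0 = 0`, and the bound is `0 ≤ 2`.
    norm_num
  | succ n ih =>
    rw [Finset.sum_range_succ]
    rcases Nat.eq_zero_or_pos n with rfl | hn
    · norm_num
    have hn' : (0 : ℝ) < n := by exact_mod_cast hn
    have h : 1 / ((n : ℝ) + 1) ^ 2 ≤ 1 / n - 1 / ((n : ℝ) + 1) := by
      rw [div_sub_div _ _ hn'.ne' (by positivity), div_le_div_iff₀ (by positivity) (by positivity)]
      nlinarith
    push_cast at ih ⊢
    linarith

lemma expectation_sqrtPotential_le (T : ℕ) :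
    expectation μ π T sqrtPotential ≤ N * √(T : ℝ) := by
  rw [← expectation_const (μ := μ) (π := π) T (N * √(T : ℝ))]
  refine expectation_mono T fun s hs => ?_
  have h : ∀ i ∈ Finset.univ, √(pulls (s i) : ℝ) ≤ √(T : ℝ) := fun i _ =>
    Real.sqrt_le_sqrt (by
      have := (mem_armStates_of_mem_states hs i).2.2
      exact_mod_cast Nat.le_of_succ_le_succ this)
  simpa [sqrtPotential] using Finset.sum_le_sum h

end ELSV

theorem theorem2 (N : ℕ) (hN : 0 < N) :
    ∃ C : ℝ, ∀ (T : ℕ), 2 ≤ T → ∀ (μ : Fin N → unitInterval)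
      (z u : ℕ → Fin N → ELSV.ArmState → ℝ) (π : ℕ → ELSV.State N → Fin N),
      ELSV.IsUCBIndex 2 T z → ELSV.IsELSV T z u →
      ELSV.IsLookahead T (ELSV.separable u) π →
      ELSV.regret π T μ ≤ C * √((T : ℝ) * Real.log (T : ℝ)) := by
  refine ⟨16 * N, fun T hT μ z u π hz hu hπ => ?_⟩
  have : Nonempty (Fin N) := ⟨⟨0, hN⟩⟩
  obtain ⟨j, hj⟩ := exists_eq_ciSup_of_finite (f := fun i => (μ i : ℝ))
  have hT' : (2 : ℝ) ≤ T := by exact_mod_cast hT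
  have hlog := ELSV.one_le_two_mul_log hT
  have hroot : 1 ≤ √((T : ℝ) * Real.log T) := Real.one_le_sqrt.2 (by nlinarith)
  have hinit : ELSV.expectation μ π 0 ELSV.sqrtPotential = 0 := by
    simp [ELSV.expectation, ELSV.sqrtPotential, ELSV.pulls]
  rw [ELSV.regret, ← hj, ← Finset.Ico_add_one_right_eq_Icc, Finset.sum_Ico_eq_sum_range,
    Nat.add_sub_cancel]
  simp only [add_comm 1]
  calc _ ≤ ∑ k ∈ Finset.range T, (8 * √(Real.log T) *
        (ELSV.expectation μ π (k + 1) ELSV.sqrtPotential -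
          ELSV.expectation μ π k ELSV.sqrtPotential) +
        4 * N * (1 / ((k + 1 : ℕ) : ℝ) ^ 2)) :=
        Finset.sum_le_sum fun k hk => ELSV.sub_expectedReward_le hT hz hu hπ
          (Finset.mem_range.1 hk) j
    _ = 8 * √(Real.log T) * ELSV.expectation μ π T ELSV.sqrtPotential +
        4 * N * ∑ k ∈ Finset.range T, 1 / ((k + 1 : ℕ) : ℝ) ^ 2 := by
        rw [Finset.sum_add_distrib, ← Finset.mul_sum, ← Finset.mul_sum,
          Finset.sum_range_sub (fun k => ELSV.expectation μ π k ELSV.sqrtPotential), hinit, sub_zero]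
    _ ≤ 8 * √(Real.log T) * (N * √(T : ℝ)) + 4 * N * 2 := by
        gcongr
        · exact ELSV.expectation_sqrtPotential_le T
        · have := ELSV.sum_one_div_sq_le T
          have : (0 : ℝ) ≤ 1 / (T : ℝ) := by positivity
          linarith
    _ = 8 * N * √((T : ℝ) * Real.log T) + 8 * N * 1 := by
        rw [Real.sqrt_mul (by positivity)]
        ring
    _ ≤ 8 * N * √((T : ℝ) * Real.log T) + 8 * N * √((T : ℝ) * Real.log T) := by
        gcongr
    _ = 16 * N * √((T : ℝ) * Real.log T) := by ring
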